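/- Let $C[0,1]$ be the space of real-valued continuous functions on $[0,1]$ with the supremum norm. Let $\Lambda=(\lambda_i)_{i=0}^\infty$ be a strictly increasing sequence of non-negative real numbers with $\lambda_0=0$ and $\sum_{i=1}^\infty 1/\lambda_i<\infty$ (a Müntz sequence). Let $M(\Lambda)$ (the Müntz space) be the closed linear span of $\{t^{\lambda_i} : i\ge 0\}$ in $C[0,1]$, and let $M_0(\Lambda)$ be the closed linear span of $\{t^{\lambda_i} : i\ge 1\}$ in $C[0,1]$. A real Banach space $X$ is called locally almost square if for every $x\in X$ with $\|x\|=1$ there is a sequence $(y_n)$ in $X$ with $\|y_n\|\le 1$ for all $n$ such that $\|x+y_n\|\to 1$, $\|x-y_n\|\to 1$ and $\|y_n\|\to 1$. If $\lambda_1\ge 1$, then $M(\Lambda)$ is not locally almost square, and $M_0(\Lambda)$ is not locally almost square. -/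

import Mathlib

open Filter Topology
open scoped NNReal unitInterval

noncomputable section

/-- A Müntz sequence: a strictly increasing sequence `0 = Λ 0 < Λ 1 < Λ 2 < ⋯` of
non-negative real numbers with `∑_{i ≥ 1} 1 / Λ i < ∞`. -/
structure IsMuntzSequence (Λ : ℕ → ℝ≥0) : Prop where
  zero : Λ 0 = 0
  strictMono : StrictMono Λ
  summable : Summable fun i : ℕ => 1 / (Λ (i + 1) : ℝ)

/-- The function `t ↦ t ^ r` in `C[0,1]`, for a real exponent `r ≥ 0`
(for `r = 0` it is the constant function `1`). -/
def rpowMonomial (r : ℝ≥0) : C(I, ℝ) where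
  toFun t := (t : ℝ) ^ (r : ℝ)
  continuous_toFun := (Real.continuous_rpow_const r.coe_nonneg).comp continuous_subtype_val

/-- `M(Λ)`, the closed linear span in `C[0,1]` of the functions `t ^ (Λ i)`, `i ≥ 0`. -/
def muntzSpace (Λ : ℕ → ℝ≥0) : Submodule ℝ C(I, ℝ) :=
  (Submodule.span ℝ (Set.range fun i : ℕ => rpowMonomial (Λ i))).topologicalClosure

/-- `M₀(Λ)`, the closed linear span in `C[0,1]` of the functions `t ^ (Λ i)`, `i ≥ 1`. -/
def muntzSpaceZero (Λ : ℕ → ℝ≥0) : Submodule ℝ C(I, ℝ) :=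
  (Submodule.span ℝ (Set.range fun i : ℕ => rpowMonomial (Λ (i + 1)))).topologicalClosure

/-- `X` is locally almost square: for every `x` in the unit sphere there is a sequence `y` in
the closed unit ball with `‖x ± y n‖ → 1` and `‖y n‖ → 1`. -/
def IsLocallyAlmostSquare (X : Type*) [NormedAddCommGroup X] [NormedSpace ℝ X] : Prop :=
  ∀ x : X, ‖x‖ = 1 → ∃ y : ℕ → X, (∀ n, ‖y n‖ ≤ 1) ∧
    Tendsto (fun n => ‖x + y n‖) atTop (𝓝 1) ∧
    Tendsto (fun n => ‖x - y n‖) atTop (𝓝 1) ∧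
    Tendsto (fun n => ‖y n‖) atTop (𝓝 1)

end

/-!
The space `M(Λ)` contains the constant `1`, and `max ‖1 + y‖ ‖1 - y‖ = 1 + ‖y‖`, so it cannot be
locally almost square. For `M₀(Λ)` the vector `x = t ^ Λ 1` is used: if `‖x ± y‖` is close to `1`,
then `|y t|` is bounded by about `1 - x t`, so `y` can have norm close to `1` only if it peaks near
`0`. This is impossible, because there is a `δ > 0`, depending only on `Λ`, such that
`|y s| ≤ ‖y‖ / 2` for all `y ∈ M₀(Λ)` and all `s ≤ δ` (`exists_abs_le_half_norm_near_zero`).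

The bound near `0` is obtained from the dilation operators `D_d f = f (d ·)` on `C[0,1]`, which have
every monomial as an eigenvector: `D_d t ^ r = d ^ r • t ^ r`. It suffices to find, for a total
dilation factor bounded away from `0`, an operator `R` of norm at most `1 / 2` which is diagonal on
the monomials and agrees with the dilation on `t ^ Λ i` for `1 ≤ i < 2 ^ K`, with `K` arbitrary
(`IsDominatedDilation`). This relies on two constructions.

* For `n` exponents `r` with `d ^ r ≤ 1 / 4`, the operator `D_d ^ N` agrees on these monomials with
  the remainder of `z ^ N` modulo `∏ (z - d ^ r)`, evaluated at `D_d`. Its norm is at most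
  `5 ^ n / 2 ^ N` (`isDominatedDilation_pow`).
* If `R₁`, `R₂` agree with `D_a`, `D_b` on two sets of monomials, then `(D_a - R₁) (D_b - R₂)`
  vanishes on both, so `D_a D_b` agrees on the union with an operator of norm at most
  `ε₁ + ε₂ + ε₁ ε₂` (`IsDominatedDilation.mul`).

The first construction is applied to the dyadic blocks of indices `2 ^ k ≤ i < 2 ^ (k + 1)` with
`d = (1 / 4) ^ (1 / Λ (2 ^ k))` and `N = 7 * 2 ^ k`, and the second one joins the blocks. The total
dilation factor is `(1 / 4) ^ (7 * ∑ 2 ^ k / Λ (2 ^ k))`, and the sum in the exponent converges by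
Cauchy condensation. Handling blocks of exponents rather than single exponents is what makes the
bare condition `∑ 1 / Λ i < ∞` sufficient, without any gap condition.
-/

/-! ### Dilation operators on `C[0,1]` -/

@[simp]
lemma rpowMonomial_apply (r : ℝ≥0) (t : I) : rpowMonomial r t = (t : ℝ) ^ (r : ℝ) := rfl

/-- The dilation `f ↦ f (d ·)` on `C[0,1]`, for `0 ≤ d ≤ 1`. -/
noncomputable def dilation (d : I) : C(I, ℝ) →L[ℝ] C(I, ℝ) :=
  LinearMap.mkContinuous
    { toFun := fun f => f.comp ⟨fun t => d * t, by fun_prop⟩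
      map_add' := fun _ _ => rfl
      map_smul' := fun _ _ => rfl } 1 fun f => by
    rw [one_mul, ContinuousMap.norm_le _ (norm_nonneg f)]
    exact fun t => f.norm_coe_le_norm (d * t)

@[simp]
lemma dilation_apply (d : I) (f : C(I, ℝ)) (t : I) : dilation d f t = f (d * t) := rfl

lemma norm_dilation_le (d : I) : ‖dilation d‖ ≤ 1 :=
  LinearMap.mkContinuous_norm_le _ zero_le_one _

lemma dilation_rpowMonomial (d : I) (r : ℝ≥0) :
    dilation d (rpowMonomial r) = ((d : ℝ) ^ (r : ℝ)) • rpowMonomial r := by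
  ext t
  simp [Real.mul_rpow d.2.1 t.2.1]

lemma opNorm_mul_le_of_le {A B : C(I, ℝ) →L[ℝ] C(I, ℝ)} {a b : ℝ} (hA : ‖A‖ ≤ a) (hB : ‖B‖ ≤ b) :
    ‖A * B‖ ≤ a * b :=
  (A.opNorm_comp_le B).trans
    (mul_le_mul hA hB (ContinuousLinearMap.opNorm_nonneg _) ((norm_nonneg A).trans hA))

lemma opNorm_smul_le_of_le {A : C(I, ℝ) →L[ℝ] C(I, ℝ)} {q a b : ℝ} (hq : 0 ≤ q) (hqa : q ≤ a)
    (hA : ‖A‖ ≤ b) : ‖q • A‖ ≤ a * b := by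
  refine (ContinuousLinearMap.opNorm_smul_le q A).trans ?_
  rw [Real.norm_of_nonneg hq]
  exact mul_le_mul hqa hA (ContinuousLinearMap.opNorm_nonneg A) (hq.trans hqa)

/-- The dilation by `d` agrees on the monomials with exponents in `s` with an operator of norm at
most `ε` which has every monomial as an eigenvector. -/
def IsDominatedDilation (d : I) (s : Set ℝ≥0) (ε : ℝ) : Prop :=
  ∃ (R : C(I, ℝ) →L[ℝ] C(I, ℝ)) (ρ : ℝ≥0 → ℝ),
    (∀ r, R (rpowMonomial r) = ρ r • rpowMonomial r) ∧ ‖R‖ ≤ ε ∧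
      ∀ r ∈ s, ρ r = (d : ℝ) ^ (r : ℝ)

namespace IsDominatedDilation

lemma mono {d : I} {s t : Set ℝ≥0} {ε ε' : ℝ} (h : IsDominatedDilation d t ε) (hst : s ⊆ t)
    (hε : ε ≤ ε') : IsDominatedDilation d s ε' := by
  obtain ⟨R, ρ, h1, h2, h3⟩ := h
  exact ⟨R, ρ, h1, h2.trans hε, fun r hr => h3 r (hst hr)⟩

lemma empty (d : I) : IsDominatedDilation d ∅ 0 :=
  ⟨0, 0, fun r => by simp only [zero_apply, Pi.zero_apply, zero_smul],
    ContinuousLinearMap.opNorm_zero.le, fun r hr => hr.elim⟩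

lemma mul {a b : I} {s t : Set ℝ≥0} {ε₁ ε₂ : ℝ} (ha : IsDominatedDilation a s ε₁)
    (hb : IsDominatedDilation b t ε₂) :
    IsDominatedDilation (a * b) (s ∪ t) (ε₁ + ε₂ + ε₁ * ε₂) := by
  obtain ⟨R, ρ, hR, hRn, hρ⟩ := ha
  obtain ⟨S, τ, hS, hSn, hτ⟩ := hb
  -- This is `D_a D_b - (D_a - R) (D_b - S)`.
  refine ⟨dilation a * S + R * dilation b - R * S,
    fun r => (a : ℝ) ^ (r : ℝ) * τ r + ρ r * (b : ℝ) ^ (r : ℝ) - ρ r * τ r, fun r => ?_, ?_, ?_⟩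
  · simp only [sub_apply, add_apply,
      mul_apply_eq_comp, hR, hS, dilation_rpowMonomial, map_smul]
    module
  · have h1 := opNorm_mul_le_of_le (norm_dilation_le a) hSn
    have h2 := opNorm_mul_le_of_le hRn (norm_dilation_le b)
    have h3 := opNorm_mul_le_of_le hRn hSn
    linarith [norm_sub_le (dilation a * S + R * dilation b) (R * S),
      norm_add_le (dilation a * S) (R * dilation b)]
  · rintro r (hr | hr)
    · simp only [hρ r hr, Set.Icc.coe_mul, Real.mul_rpow a.2.1 b.2.1]
      ring
    · simp only [hτ r hr, Set.Icc.coe_mul, Real.mul_rpow a.2.1 b.2.1]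
      ring

/-- If `f` is a combination of monomials with exponents in `s`, then the dilation of `f` by `d` has
norm at most `ε ‖f‖`. -/
lemma abs_apply_le {d : I} {s : Set ℝ≥0} {ε : ℝ} (h : IsDominatedDilation d s ε) {f : C(I, ℝ)}
    (hf : f ∈ Submodule.span ℝ (rpowMonomial '' s)) (t : I) : |f (d * t)| ≤ ε * ‖f‖ := by
  obtain ⟨R, ρ, hR, hRn, hρ⟩ := h
  have heq : Set.EqOn (dilation d : C(I, ℝ) →ₗ[ℝ] C(I, ℝ)) R
      (Submodule.span ℝ (rpowMonomial '' s)) := by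
    refine LinearMap.eqOn_span' (f := (dilation d : C(I, ℝ) →ₗ[ℝ] C(I, ℝ)))
      (g := (R : C(I, ℝ) →ₗ[ℝ] C(I, ℝ))) ?_
    rintro _ ⟨r, hr, rfl⟩
    simp [dilation_rpowMonomial, hR, hρ r hr]
  have hfd : dilation d f = R f := heq hf
  calc |f (d * t)| = ‖dilation d f t‖ := rfl
    _ ≤ ‖dilation d f‖ := ContinuousMap.norm_coe_le_norm _ t
    _ = ‖R f‖ := by rw [hfd]
    _ ≤ ε * ‖f‖ := R.le_of_opNorm_le hRn f

end IsDominatedDilation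

/-- The constant `5 ^ n / 2 ^ N` bounds the coefficients of the remainder of `z ^ N` modulo a
product of `n` factors `z - q` with `0 ≤ q ≤ 1 / 4`. -/
lemma isDominatedDilation_pow (d : I) (s : Finset ℝ≥0)
    (hs : ∀ r ∈ s, (d : ℝ) ^ (r : ℝ) ≤ 1 / 4) (N : ℕ) :
    IsDominatedDilation (d ^ N) s (5 ^ s.card * (1 / 2) ^ N) := by
  induction s using Finset.induction_on generalizing N with
  | empty => simpa using (IsDominatedDilation.empty (d ^ N)).mono subset_rfl (by positivity)
  | insert r₀ s hr₀ ih =>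
    have ih := ih fun r hr => hs r (Finset.mem_insert_of_mem hr)
    induction N with
    | zero =>
      refine ⟨1, 1, by simp, ContinuousLinearMap.norm_id_le.trans ?_, by simp⟩
      simpa using one_le_pow₀ (M₀ := ℝ) (by norm_num : (1 : ℝ) ≤ 5)
    | succ N ihN =>
      obtain ⟨R, ρ, hR, hRn, hρ⟩ := ih N
      obtain ⟨S, τ, hS, hSn, hτ⟩ := ihN
      set q : ℝ := (d : ℝ) ^ (r₀ : ℝ) with hq
      have hq0 : 0 ≤ q := Real.rpow_nonneg d.2.1 _
      have hq4 : q ≤ 1 / 4 := hs r₀ (Finset.mem_insert_self _ _)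
      -- If `R`, `S` are the remainders of `z ^ N` without and with the factor `z - q`,
      -- then `(z - q) R + q S` is the remainder of `z ^ (N + 1)` with that factor.
      refine ⟨(dilation d - q • 1) * R + q • S,
        fun r => ((d : ℝ) ^ (r : ℝ) - q) * ρ r + q * τ r, fun r => ?_, ?_, fun r hr => ?_⟩
      · simp only [sub_apply, add_apply,
          mul_apply_eq_comp, smul_apply,
          one_apply_eq_self, hR, hS, dilation_rpowMonomial, map_smul]
        module
      · have h1 : ‖dilation d - q • (1 : C(I, ℝ) →L[ℝ] C(I, ℝ))‖ ≤ 1 + 1 / 4 := by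
          have hq1 := opNorm_smul_le_of_le hq0 hq4
            (ContinuousLinearMap.norm_id_le (𝕜 := ℝ) (E := C(I, ℝ)))
          rw [mul_one] at hq1
          exact (norm_sub_le (dilation d) _).trans (add_le_add (norm_dilation_le d) hq1)
        have h2 := opNorm_mul_le_of_le h1 hRn
        have h3 := opNorm_smul_le_of_le hq0 hq4 hSn
        refine (norm_add_le ((dilation d - q • 1) * R) (q • S)).trans
          ((add_le_add h2 h3).trans (le_of_eq ?_))
        rw [Finset.card_insert_of_notMem hr₀]
        ring
      · have hpow (M : ℕ) : ((d ^ M : I) : ℝ) ^ (r : ℝ) = ((d : ℝ) ^ (r : ℝ)) ^ M := by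
          rw [Set.Icc.coe_pow, ← Real.rpow_natCast, ← Real.rpow_natCast, ← Real.rpow_mul d.2.1,
            ← Real.rpow_mul d.2.1, mul_comm]
        simp only [hτ r hr, hpow]
        rcases Finset.mem_insert.1 (Finset.mem_coe.1 hr) with rfl | hr'
        · rw [← hq]
          ring
        · rw [hρ r hr', hpow]
          ring

/-! ### Behaviour of Müntz functions near `0` -/

lemma IsMuntzSequence.pos {Λ : ℕ → ℝ≥0} (hΛ : IsMuntzSequence Λ) {i : ℕ} (hi : 0 < i) :
    (0 : ℝ) < Λ i := by
  have h := hΛ.strictMono hi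
  rw [hΛ.zero] at h
  exact_mod_cast h

lemma IsMuntzSequence.summable_condensed {Λ : ℕ → ℝ≥0} (hΛ : IsMuntzSequence Λ) :
    Summable fun k : ℕ => (2 : ℝ) ^ k * (1 / (Λ (2 ^ k) : ℝ)) := by
  refine (summable_condensed_iff_of_nonneg (f := fun n => 1 / (Λ n : ℝ)) (fun n => by positivity)
    fun _ _ hm hmn => ?_).2 ((summable_nat_add_iff 1).1 hΛ.summable)
  exact one_div_le_one_div_of_le (hΛ.pos hm) (by exact_mod_cast hΛ.strictMono.monotone hmn)

lemma IsMuntzSequence.isDominatedDilation_block {Λ : ℕ → ℝ≥0} (hΛ : IsMuntzSequence Λ) (k : ℕ) :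
    ∃ d : I, (d : ℝ) = (1 / 4 : ℝ) ^ (7 * ((2 : ℝ) ^ k * (1 / (Λ (2 ^ k) : ℝ)))) ∧
      IsDominatedDilation d (Λ '' Set.Ico (2 ^ k) (2 ^ (k + 1))) ((1 / 2) ^ (k + 3)) := by
  have hpos : (0 : ℝ) < Λ (2 ^ k) := hΛ.pos (by positivity)
  let d : I := ⟨(1 / 4 : ℝ) ^ (1 / (Λ (2 ^ k) : ℝ)), by positivity,
    Real.rpow_le_one (by norm_num) (by norm_num) (by positivity)⟩
  have hd : (d : ℝ) = (1 / 4 : ℝ) ^ (1 / (Λ (2 ^ k) : ℝ)) := rfl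
  refine ⟨d ^ (7 * 2 ^ k), ?_, ?_⟩
  · rw [Set.Icc.coe_pow, hd, ← Real.rpow_natCast, ← Real.rpow_mul (by norm_num)]
    push_cast
    ring_nf
  · have key := isDominatedDilation_pow d ((Finset.Ico (2 ^ k) (2 ^ (k + 1))).image Λ) ?_
      (7 * 2 ^ k)
    · refine key.mono (by simp) ?_
      rw [Finset.card_image_of_injective _ hΛ.strictMono.injective, Nat.card_Ico,
        show 2 ^ (k + 1) - 2 ^ k = 2 ^ k by rw [pow_succ]; omega, pow_mul, ← mul_pow]
      calc ((5 : ℝ) * (1 / 2) ^ 7) ^ 2 ^ k ≤ ((1 / 2) ^ 4) ^ 2 ^ k :=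
            pow_le_pow_left₀ (by norm_num) (by norm_num) _
        _ = (1 / 2) ^ (4 * 2 ^ k) := by rw [pow_mul]
        _ ≤ (1 / 2) ^ (k + 3) := by
            refine pow_le_pow_of_le_one (by norm_num) (by norm_num) ?_
            have := Nat.lt_two_pow_self (n := k)
            omega
    · intro r hr
      obtain ⟨i, hi, rfl⟩ := Finset.mem_image.1 hr
      have hle : (Λ (2 ^ k) : ℝ) ≤ Λ i := by
        exact_mod_cast hΛ.strictMono.monotone (Finset.mem_Ico.1 hi).1
      rw [hd, ← Real.rpow_mul (by norm_num)]
      calc (1 / 4 : ℝ) ^ (1 / (Λ (2 ^ k) : ℝ) * Λ i) ≤ (1 / 4 : ℝ) ^ (1 : ℝ) := by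
            refine Real.rpow_le_rpow_of_exponent_ge (by norm_num) (by norm_num) ?_
            rw [one_div_mul_eq_div]
            exact (one_le_div hpos).2 hle
        _ = 1 / 4 := Real.rpow_one _

lemma IsMuntzSequence.isDominatedDilation_initial {Λ : ℕ → ℝ≥0} (hΛ : IsMuntzSequence Λ) (K : ℕ) :
    ∃ d : I, (d : ℝ) =
        (1 / 4 : ℝ) ^ (7 * ∑ k ∈ Finset.range K, (2 : ℝ) ^ k * (1 / (Λ (2 ^ k) : ℝ))) ∧
      IsDominatedDilation d (Λ '' Set.Ico 1 (2 ^ K)) (1 / 2 * (1 - (1 / 2) ^ K)) := by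
  induction K with
  | zero => exact ⟨1, by simp, by simpa using IsDominatedDilation.empty 1⟩
  | succ K ih =>
    obtain ⟨a, ha, hda⟩ := ih
    obtain ⟨b, hb, hdb⟩ := hΛ.isDominatedDilation_block K
    refine ⟨a * b, ?_, (hda.mul hdb).mono ?_ ?_⟩
    · rw [Set.Icc.coe_mul, ha, hb, ← Real.rpow_add (by norm_num), Finset.sum_range_succ,
        mul_add]
    · rw [← Set.image_union, Set.Ico_union_Ico_eq_Ico Nat.one_le_two_pow
        (Nat.pow_le_pow_right two_pos K.le_succ)]
    · have h0 : (0 : ℝ) < (1 / 2) ^ K := by positivity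
      rw [pow_succ _ K, pow_add]
      nlinarith [mul_pos h0 h0]

/-- A Bernstein-type bound: functions in the unit ball of `M₀(Λ)` are uniformly small near `0`. -/
lemma exists_abs_le_half_norm_near_zero {Λ : ℕ → ℝ≥0} (hΛ : IsMuntzSequence Λ) :
    ∃ δ : ℝ, 0 < δ ∧ ∀ f ∈ muntzSpaceZero Λ, ∀ s : I, (s : ℝ) ≤ δ → |f s| ≤ 1 / 2 * ‖f‖ := by
  set H : ℝ := ∑' k : ℕ, (2 : ℝ) ^ k * (1 / (Λ (2 ^ k) : ℝ)) with hH
  refine ⟨(1 / 4 : ℝ) ^ (7 * H), by positivity, fun f hf s hs => ?_⟩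
  have hclosed : IsClosed {g : C(I, ℝ) | |g s| ≤ 1 / 2 * ‖g‖} :=
    isClosed_le (by fun_prop) (by fun_prop)
  refine closure_minimal (fun g hg => ?_) hclosed hf
  -- A finite combination only involves exponents `Λ i` with `1 ≤ i < 2 ^ K` for some `K`.
  obtain ⟨K, hK⟩ : ∃ K : ℕ, g ∈ Submodule.span ℝ (rpowMonomial '' (Λ '' Set.Ico 1 (2 ^ K))) := by
    have hU : (Set.range fun i : ℕ => rpowMonomial (Λ (i + 1))) ⊆
        ⋃ K : ℕ, (Submodule.span ℝ (rpowMonomial '' (Λ '' Set.Ico 1 (2 ^ K))) : Set C(I, ℝ)) := by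
      rintro _ ⟨i, rfl⟩
      exact Set.mem_iUnion.2 ⟨i + 1, Submodule.subset_span ⟨_, ⟨i + 1,
        ⟨by omega, Nat.lt_two_pow_self⟩, rfl⟩, rfl⟩⟩
    have hdir : Directed (· ≤ ·) fun K : ℕ =>
        Submodule.span ℝ (rpowMonomial '' (Λ '' Set.Ico 1 (2 ^ K))) :=
      Monotone.directed_le fun m n hmn => Submodule.span_mono <| Set.image_mono <|
        Set.image_mono <| Set.Ico_subset_Ico_right (Nat.pow_le_pow_right two_pos hmn)
    rw [← Submodule.coe_iSup_of_directed _ hdir] at hU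
    exact (Submodule.mem_iSup_of_directed _ hdir).1 (Submodule.span_le.2 hU hg)
  obtain ⟨d, hd, hdom⟩ := hΛ.isDominatedDilation_initial K
  have hsd : (s : ℝ) ≤ d := by
    rw [hd]
    refine hs.trans (Real.rpow_le_rpow_of_exponent_ge (by norm_num) (by norm_num) ?_)
    gcongr
    exact hΛ.summable_condensed.sum_le_tsum _ fun k _ => by positivity
  have hd0 : (0 : ℝ) < d := by
    rw [hd]
    positivity
  let t : I := ⟨s / d, div_nonneg s.2.1 hd0.le, (div_le_one hd0).2 hsd⟩
  have hst : d * t = s := Subtype.ext (mul_div_cancel₀ _ hd0.ne')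
  have hgt := hdom.abs_apply_le hK t
  rw [hst] at hgt
  refine hgt.trans (mul_le_mul_of_nonneg_right ?_ (norm_nonneg g))
  have : (0 : ℝ) < (1 / 2) ^ K := by positivity
  linarith

/-! ### Failure of local almost squareness -/

/-- A vector `x` of norm `1` obstructs local almost squareness if elements of the unit ball are
bounded by some `θ < 1` wherever `x` is not bounded below by a fixed `c > 0`: where `x ≥ c`, a
function `y` with `‖x ± y‖ ≤ m` satisfies `|y| ≤ m - c`. -/
lemma not_isLocallyAlmostSquare_of_le {V : Submodule ℝ C(I, ℝ)} (x : V) (hx : ‖x‖ = 1) {θ c : ℝ}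
    (hθ : θ < 1) (hc : 0 < c)
    (h : ∀ y ∈ V, ‖y‖ ≤ 1 → ∀ t : I, |y t| ≤ θ ∨ c ≤ (x : C(I, ℝ)) t) :
    ¬ IsLocallyAlmostSquare V := by
  intro hV
  obtain ⟨y, hy, hadd, hsub, hnorm⟩ := hV x hx
  have hle (n : ℕ) : ‖y n‖ ≤ max (max θ 0) (max ‖x + y n‖ ‖x - y n‖ - c) := by
    refine (ContinuousMap.norm_le (y n : C(I, ℝ)) (le_max_of_le_left (le_max_right _ _))).2 ?_
    intro t
    rw [Real.norm_eq_abs]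
    rcases h (y n) (y n).2 (hy n) t with ht | ht
    · exact le_max_of_le_left (le_max_of_le_left ht)
    · refine le_max_of_le_right (abs_le'.2 ⟨?_, ?_⟩)
      · have h1 : (x : C(I, ℝ)) t + (y n : C(I, ℝ)) t ≤ ‖x + y n‖ :=
          (le_abs_self _).trans (((x + y n : V) : C(I, ℝ)).norm_coe_le_norm t)
        linarith [le_max_left ‖x + y n‖ ‖x - y n‖]
      · have h1 : (x : C(I, ℝ)) t - (y n : C(I, ℝ)) t ≤ ‖x - y n‖ :=
          (le_abs_self _).trans (((x - y n : V) : C(I, ℝ)).norm_coe_le_norm t)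
        linarith [le_max_right ‖x + y n‖ ‖x - y n‖]
  have hlim := le_of_tendsto_of_tendsto' hnorm
    (tendsto_const_nhds.max ((hadd.max hsub).sub_const c)) hle
  rw [max_self] at hlim
  exact absurd hlim (not_le.2 (max_lt (max_lt hθ one_pos) (by linarith)))

lemma norm_rpowMonomial (r : ℝ≥0) : ‖rpowMonomial r‖ = 1 := by
  refine le_antisymm ((ContinuousMap.norm_le _ zero_le_one).2 fun t => ?_) ?_
  · rw [rpowMonomial_apply, Real.norm_of_nonneg (Real.rpow_nonneg t.2.1 _)]
    exact Real.rpow_le_one t.2.1 t.2.2 r.2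
  · simpa using (rpowMonomial r).norm_coe_le_norm 1

theorem mainTheorem5 (Λ : ℕ → ℝ≥0) (hΛ : IsMuntzSequence Λ) (h1 : 1 ≤ Λ 1) :
    ¬ IsLocallyAlmostSquare (muntzSpace Λ) ∧
      ¬ IsLocallyAlmostSquare (muntzSpaceZero Λ) := by
  constructor
  · let x : muntzSpace Λ := ⟨rpowMonomial (Λ 0),
      Submodule.le_topologicalClosure _ (Submodule.subset_span ⟨0, rfl⟩)⟩
    refine not_isLocallyAlmostSquare_of_le x (norm_rpowMonomial _) zero_lt_one one_pos
      fun y _ _ t => Or.inr ?_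
    simp [x, hΛ.zero]
  · let x : muntzSpaceZero Λ := ⟨rpowMonomial (Λ 1),
      Submodule.le_topologicalClosure _ (Submodule.subset_span ⟨0, rfl⟩)⟩
    obtain ⟨δ, hδ, hsmall⟩ := exists_abs_le_half_norm_near_zero hΛ
    refine not_isLocallyAlmostSquare_of_le x (norm_rpowMonomial _) (θ := 1 / 2)
      (c := δ ^ (Λ 1 : ℝ)) (by norm_num) (by positivity) fun y hy hy1 t => ?_
    rcases le_total (t : ℝ) δ with ht | ht
    · exact Or.inl ((hsmall y hy t ht).trans (by linarith))
    · exact Or.inr (Real.rpow_le_rpow hδ.le ht (Λ 1).2)
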